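/- Let $n\ge 0$ and let $S:\mathbb{R}\rightrightarrows\mathbb{R}^n$ be a multivalued map with closed graph $\mathcal{S}=\{(t,x)\in\mathbb{R}^{n+1}: x\in S(t)\}$, domain $\mathrm{dom}(S)=\{t: S(t)\neq\emptyset\}$ and $T=\sup(\mathrm{dom}(S))\in\mathbb{R}\cup\{+\infty\}$. Assume that $S$ is a smooth sweeping process, that is, $\mathcal{S}$ is connected and either - $\mathcal{S}$ is a (closed, embedded) $C^1$-smooth submanifold of $\mathbb{R}^{n+1}$ of dimension at most $n$; or - $\mathcal{S}$ is a $C^1$-smooth manifold with boundary, of full dimension $n+1$ in $\mathbb{R}^{n+1}$, and its boundary $\partial\mathcal{S}$ is a $C^1$-smooth submanifold of dimension $n$ (possibly empty). For a closed set $C\subseteq\mathbb{R}^{n+1}$ and $z\in C$, let $\hat N_C(z)$ be the set of all $v$ with $\limsup_{y\to z,\,y\in C\setminus\{z\}}\langle v,y-z\rangle/\|y-z\|\le 0$, and let $N_C(z)$ be the set of all limits $v=\lim_i v_i$ with $v_i\in\hat N_C(z_i)$, $z_i\in C$, $z_i\to z$. For $(t,x)\in\mathcal{S}$ and $u\in\mathbb{R}^n$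 put $D^*S(t,x)(u)=\{a\in\mathbb{R}: (a,-u)\in N_{\mathcal{S}}(t,x)\}$ and $$\|D^*S(t,x)|^+=\sup\{\max\{0,a\}: a\in D^*S(t,x)(u),\ \|u\|\le 1\}\in[0,+\infty].$$ Let $B$ be the open unit ball of $\mathbb{R}^n$ and $B(x,\delta)$ the open ball of radius $\delta$ about $x$. The oriented calm modulus $\mathrm{calm}^{\uparrow}S(t,x)\in[0,+\infty]$ is the infimum (with $\inf\emptyset=+\infty$) of all $\kappa>0$ for which there exist $\epsilon>0$ and $\delta>0$ such that $$S(t)\cap B(x,\delta)\subset S(t_1)+\kappa|t_1-t|B\qquad\text{for all }t_1\in(t,t+\epsilon).$$ Then, for every $t\in\mathrm{dom}(S)\setminus\{T\}$ and every $x\in S(t)$ with $\|D^*S(t,x)|^+<+\infty$, $$\mathrm{calm}^{\uparrow}S(t,x)=\|D^*S(t,x)|^+.$$ -/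

import Mathlib

open Filter Topology
open scoped Pointwise ENNReal

namespace SweepingProcess

noncomputable section

section NormalCones

variable {E : Type*} [NormedAddCommGroup E] [InnerProductSpace ℝ E]

/-- The Fréchet normal cone to `C` at `x`: the vectors `v` with
`limsup ⟨v, y - x⟩ / ‖y - x‖ ≤ 0` as `y → x`, `y ∈ C`, `y ≠ x`. The upper limit is taken in the
extended reals, so it is `-∞` when `x` is an isolated point of `C`. -/
def frechetNormalCone (C : Set E) (x : E) : Set E :=
  {v | limsup (fun y : E => ((inner ℝ v (y - x) / ‖y - x‖ : ℝ) : EReal)) (𝓝[C \ {x}] x) ≤ 0}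

/-- The limiting normal cone to `C` at `x`. -/
def limitingNormalCone (C : Set E) (x : E) : Set E :=
  {v | ∃ (z w : ℕ → E), (∀ i, z i ∈ C) ∧ (∀ i, w i ∈ frechetNormalCone C (z i)) ∧
    Tendsto z atTop (𝓝 x) ∧ Tendsto w atTop (𝓝 v)}

end NormalCones

section Submanifolds

variable {E : Type*} [NormedAddCommGroup E] [NormedSpace ℝ E] {m : ℕ}

/-- `φ` is a `C¹` diffeomorphism between open subsets of `E` and of `ℝᵐ`. -/
def IsC1Diffeo (φ : OpenPartialHomeomorph E (EuclideanSpace ℝ (Fin m))) : Prop :=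
  ContDiffOn ℝ 1 φ φ.source ∧ ContDiffOn ℝ 1 φ.symm φ.target

/-- `M` is an (embedded) `C¹`-smooth submanifold, without boundary, of dimension `d` of the
`m`-dimensional space `E`: around each of its points, some `C¹` diffeomorphism onto an open subset
of `ℝᵐ` straightens `M` to the coordinate subspace of vectors whose coordinates of
(zero-based) index at least `d` vanish. -/
def IsC1Submanifold (m d : ℕ) (M : Set E) : Prop :=
  d ≤ m ∧ ∀ p ∈ M, ∃ φ : OpenPartialHomeomorph E (EuclideanSpace ℝ (Fin m)),
    p ∈ φ.source ∧ IsC1Diffeo φ ∧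
      ∀ z ∈ φ.source, z ∈ M ↔ ∀ i : Fin m, d ≤ (i : ℕ) → φ z i = 0

/-- `M` is a `C¹`-smooth submanifold with (possibly empty) boundary of full dimension `n + 1` of
the `(n + 1)`-dimensional space `E`: around each of its points, some `C¹` diffeomorphism onto an
open subset of `ℝⁿ⁺¹` maps `M` to the half-space of vectors with nonnegative first coordinate. -/
def IsC1FullDimWithBoundary (n : ℕ) (M : Set E) : Prop :=
  ∀ p ∈ M, ∃ φ : OpenPartialHomeomorph E (EuclideanSpace ℝ (Fin (n + 1))),
    p ∈ φ.source ∧ IsC1Diffeo φ ∧ ∀ z ∈ φ.source, z ∈ M ↔ 0 ≤ φ z 0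

end Submanifolds

variable {n : ℕ}

/-- The effective domain of the multivalued map `S`. -/
def dom (S : ℝ → Set (EuclideanSpace ℝ (Fin n))) : Set ℝ :=
  {t | (S t).Nonempty}

/-- The supremum `T ∈ ℝ ∪ {+∞}` of the effective domain, as an extended real. -/
def supDom (S : ℝ → Set (EuclideanSpace ℝ (Fin n))) : EReal :=
  sSup ((fun t : ℝ => (t : EReal)) '' dom S)

/-- The graph of `S`, a subset of `ℝ × ℝⁿ = ℝⁿ⁺¹` with its Euclidean structure. -/
def graph (S : ℝ → Set (EuclideanSpace ℝ (Fin n))) :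
    Set (WithLp 2 (ℝ × EuclideanSpace ℝ (Fin n))) :=
  {z | z.snd ∈ S z.fst}

/-- Smooth sweeping processes. -/
def IsSmoothSweepingProcess (S : ℝ → Set (EuclideanSpace ℝ (Fin n))) : Prop :=
  IsClosed (graph S) ∧ IsConnected (graph S) ∧
    ((∃ d ≤ n, IsC1Submanifold (n + 1) d (graph S)) ∨
      (IsC1FullDimWithBoundary n (graph S) ∧ IsC1Submanifold (n + 1) n (frontier (graph S))))

/-- The (limiting) coderivative `D*S(t,x)(u) = {a | (a, -u) ∈ N_{gph S}(t,x)}`. -/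
def coderivative (S : ℝ → Set (EuclideanSpace ℝ (Fin n))) (t : ℝ)
    (x u : EuclideanSpace ℝ (Fin n)) : Set ℝ :=
  {a | WithLp.toLp 2 (a, -u) ∈ limitingNormalCone (graph S) (WithLp.toLp 2 (t, x))}

/-- The asymmetric modulus `‖D*S(t,x)|⁺ = sup {a⁺ | a ∈ D*S(t,x)(u), ‖u‖ ≤ 1}` in `[0, +∞]`,
with `sup ∅ = 0`. -/
def asymModulus (S : ℝ → Set (EuclideanSpace ℝ (Fin n))) (t : ℝ)
    (x : EuclideanSpace ℝ (Fin n)) : ℝ≥0∞ :=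
  sSup {r | ∃ (u : EuclideanSpace ℝ (Fin n)) (a : ℝ), ‖u‖ ≤ 1 ∧ a ∈ coderivative S t x u ∧
    r = ENNReal.ofReal (max 0 a)}

/-- The oriented calm graphical modulus of `S` at `t` for `x`, in `[0, +∞]`, with `inf ∅ = +∞`. -/
def calmUp (S : ℝ → Set (EuclideanSpace ℝ (Fin n))) (t : ℝ)
    (x : EuclideanSpace ℝ (Fin n)) : ℝ≥0∞ :=
  sInf {r | ∃ κ : ℝ, 0 < κ ∧ r = ENNReal.ofReal κ ∧ ∃ ε > 0, ∃ δ > 0,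
    ∀ t₁ ∈ Set.Ioo t (t + ε),
      S t ∩ Metric.ball x δ ⊆
        S t₁ + (κ * |t₁ - t|) • Metric.ball (0 : EuclideanSpace ℝ (Fin n)) 1}

end

end SweepingProcess

/-!
Near a point `p` of the graph `M` of a smooth sweeping process there is a `C¹` diffeomorphism `φ`
for which `z ∈ M` amounts to `φ z - φ p ∈ C`, where `C` is a closed convex cone: a coordinate
subspace when `M` is a submanifold, a half-space at a boundary point, the whole space at an interior
point. The argument is the same in all three cases. Put `K = (Dφ p)⁻¹ C`, the tangent cone at `p`.

* The limiting normal cone of `M` at `p` is the polar of `K` (`inner_le_zero_of_mem_limiting`,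
  `mem_frechetNormalCone_of_polar`). Limits of normals at nearby points cause no loss,
  because `C + C ⊆ C` lets one move from every `z ∈ M` near `p` along `D(φ⁻¹) (φ z) σ`, `σ ∈ C`.
* If `κ` is admissible for `calm↑`, the points of `S t₁` that are `κ (t₁ - t)`-close to `x` produce,
  by compactness, a tangent vector `(1, w) ∈ K` with `‖w‖ ≤ κ` (`exists_tangent_of_calm`).
  Pairing it with a normal `(a, -u)`, `‖u‖ ≤ 1`, gives `a ≤ κ`; hence `‖D*S|⁺ ≤ calm↑`.
* If `κ ≥ ‖D*S|⁺`, there is `(1, w) ∈ K` with `‖w‖ ≤ κ`: otherwise a hyperplane separating `K` from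
  the compact set `{1} × κ 𝔹` would have a normal `(a, -u)` with `a > κ ‖u‖`, and a positive
  multiple of it with `‖u‖ ≤ 1` would have `a > κ` (`exists_tangent_of_asymModulus_le`).
* If `(1, w) ∈ K` and `‖w‖ < κ`, then `κ` is admissible (`calm_of_tangent`): for every `q ∈ M`
  near `p` the curve `s ↦ φ⁻¹ (φ q + s Dφ p (1, w))` stays in `M`, and by strict differentiability
  it is `q + s (1, w)` up to an error uniformly small relative to `s`; by the intermediate value
  theorem it meets every time `t₁` slightly later than `t`. The last two steps give
  `calm↑ ≤ ‖D*S|⁺` when the right-hand side is finite.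
-/

namespace SweepingProcess

/-! ### Fréchet normals -/

section Normals

variable {E : Type*} [NormedAddCommGroup E] [InnerProductSpace ℝ E]

/-- Every `ε` above the upper limit eventually bounds the quotient; allowing `y = z` in the
resulting estimate is harmless, as both sides vanish there. -/
lemma eventually_inner_le_of_mem_frechet {M : Set E} {z v : E} (hv : v ∈ frechetNormalCone M z)
    {ε : ℝ} (hε : 0 < ε) : ∀ᶠ y in 𝓝[M] z, inner ℝ v (y - z) ≤ ε * ‖y - z‖ := by
  have h : limsup (fun y : E => ((inner ℝ v (y - z) / ‖y - z‖ : ℝ) : EReal)) (𝓝[M \ {z}] z)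
      < (ε : EReal) := lt_of_le_of_lt hv (by exact_mod_cast hε)
  have h1 := eventually_lt_of_limsup_lt h
  rw [eventually_nhdsWithin_iff] at h1 ⊢
  filter_upwards [h1] with y hy hyM
  by_cases hyz : y = z
  · simp [hyz]
  · have h2 : inner ℝ v (y - z) / ‖y - z‖ < ε := by exact_mod_cast hy ⟨hyM, hyz⟩
    exact ((div_lt_iff₀ (norm_pos_iff.2 (sub_ne_zero.2 hyz))).1 h2).le

lemma mem_frechet_of_eventually {M : Set E} {z v : E}
    (h : ∀ ε > 0, ∀ᶠ y in 𝓝[M] z, inner ℝ v (y - z) ≤ ε * ‖y - z‖) :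
    v ∈ frechetNormalCone M z := by
  refine EReal.le_of_forall_lt_iff_le.1 fun ε hε => ?_
  have hε' : 0 < ε := by exact_mod_cast hε
  refine limsup_le_of_le (h := ?_)
  have h1 := h ε hε'
  rw [eventually_nhdsWithin_iff] at h1 ⊢
  filter_upwards [h1] with y hy hyM
  have h2 : inner ℝ v (y - z) / ‖y - z‖ ≤ ε :=
    (div_le_iff₀ (norm_pos_iff.2 (sub_ne_zero.2 hyM.2))).2 (hy hyM.1)
  exact_mod_cast h2

/-- Fréchet normals are polar to the initial velocities of curves in the set. -/
lemma inner_le_zero_of_curve {M : Set E} {z v τ : E} (hv : v ∈ frechetNormalCone M z)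
    {γ : ℝ → E} (hγ : HasDerivAt γ τ 0) (h0 : γ 0 = z) (hM : ∀ᶠ s in 𝓝[>] (0 : ℝ), γ s ∈ M) :
    inner ℝ v τ ≤ 0 := by
  have hslope : Tendsto (fun s : ℝ => s⁻¹ • (γ s - z)) (𝓝[>] 0) (𝓝 τ) := by
    have := hγ.tendsto_slope_zero_right
    simpa [h0] using this
  have hγM : Tendsto γ (𝓝[>] 0) (𝓝[M] z) :=
    tendsto_nhdsWithin_iff.2
      ⟨h0 ▸ hγ.continuousAt.tendsto.mono_left nhdsWithin_le_nhds, hM⟩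
  have hle : ∀ ε > 0, inner ℝ v τ ≤ ε * ‖τ‖ := by
    intro ε hε
    refine le_of_tendsto_of_tendsto ((tendsto_const_nhds (x := v)).inner hslope)
      (hslope.norm.const_mul ε) ?_
    filter_upwards [hγM.eventually (eventually_inner_le_of_mem_frechet hv hε),
      self_mem_nhdsWithin] with s hs (hs0 : 0 < s)
    have h1 : 0 ≤ s⁻¹ := by positivity
    rw [real_inner_smul_right, norm_smul, Real.norm_of_nonneg h1]
    calc s⁻¹ * inner ℝ v (γ s - z) ≤ s⁻¹ * (ε * ‖γ s - z‖) := by gcongr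
      _ = ε * (s⁻¹ * ‖γ s - z‖) := by ring
  have hlim : Tendsto (fun ε : ℝ => ε * ‖τ‖) (𝓝[>] 0) (𝓝 0) := by
    have : Tendsto (fun ε : ℝ => ε * ‖τ‖) (𝓝 0) (𝓝 (0 * ‖τ‖)) := tendsto_id.mul_const _
    rw [zero_mul] at this
    exact this.mono_left nhdsWithin_le_nhds
  exact ge_of_tendsto hlim (by filter_upwards [self_mem_nhdsWithin] with ε hε using hle ε hε)

end Normals

/-! ### Charts that flatten a set to a closed convex cone -/

section ConicCharts

variable {E : Type*} [NormedAddCommGroup E] [InnerProductSpace ℝ E] {m : ℕ}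

/-- `φ` is a `C¹` chart of the ambient space at `p` in which `M` becomes `φ p + C`, with `C` a
closed convex cone. Measuring from `φ p` rather than from `0` means that `φ p` itself need not
be the origin of the chart. -/
structure IsConicChart (M : Set E) (p : E)
    (φ : OpenPartialHomeomorph E (EuclideanSpace ℝ (Fin m)))
    (C : PointedCone ℝ (EuclideanSpace ℝ (Fin m))) : Prop where
  mem_source : p ∈ φ.source
  isC1Diffeo : IsC1Diffeo φ
  isClosed : IsClosed (C : Set (EuclideanSpace ℝ (Fin m)))
  mem_iff : ∀ z ∈ φ.source, z ∈ M ↔ φ z - φ p ∈ C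

/-- The tangent cone at `p` of a set which the chart `φ` flattens to the cone `C`. -/
noncomputable def chartTangentCone (p : E)
    (φ : OpenPartialHomeomorph E (EuclideanSpace ℝ (Fin m)))
    (C : PointedCone ℝ (EuclideanSpace ℝ (Fin m))) : PointedCone ℝ E :=
  C.comap (fderiv ℝ φ p : E →ₗ[ℝ] EuclideanSpace ℝ (Fin m))

lemma mem_chartTangentCone {p τ : E} {φ : OpenPartialHomeomorph E (EuclideanSpace ℝ (Fin m))}
    {C : PointedCone ℝ (EuclideanSpace ℝ (Fin m))} :
    τ ∈ chartTangentCone p φ C ↔ fderiv ℝ φ p τ ∈ C := Iff.rfl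

namespace IsConicChart

variable {M : Set E} {p : E} {φ : OpenPartialHomeomorph E (EuclideanSpace ℝ (Fin m))}
  {C : PointedCone ℝ (EuclideanSpace ℝ (Fin m))}

lemma isClosed_chartTangentCone (h : IsConicChart M p φ C) :
    IsClosed (chartTangentCone p φ C : Set E) :=
  h.isClosed.preimage (fderiv ℝ φ p).continuous

lemma contDiffAt (h : IsConicChart M p φ C) : ContDiffAt ℝ 1 φ p :=
  h.isC1Diffeo.1.contDiffAt (φ.open_source.mem_nhds h.mem_source)

lemma contDiffAt_symm (h : IsConicChart M p φ C) {y : EuclideanSpace ℝ (Fin m)}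
    (hy : y ∈ φ.target) : ContDiffAt ℝ 1 φ.symm y :=
  h.isC1Diffeo.2.contDiffAt (φ.open_target.mem_nhds hy)

lemma hasStrictFDerivAt (h : IsConicChart M p φ C) : HasStrictFDerivAt φ (fderiv ℝ φ p) p :=
  h.contDiffAt.hasStrictFDerivAt one_ne_zero

lemma hasStrictFDerivAt_symm (h : IsConicChart M p φ C) {y : EuclideanSpace ℝ (Fin m)}
    (hy : y ∈ φ.target) : HasStrictFDerivAt φ.symm (fderiv ℝ φ.symm y) y :=
  (h.contDiffAt_symm hy).hasStrictFDerivAt one_ne_zero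

lemma fderiv_symm_fderiv (h : IsConicChart M p φ C) (τ : E) :
    fderiv ℝ φ.symm (φ p) (fderiv ℝ φ p τ) = τ := by
  have h1 := (h.hasStrictFDerivAt_symm (φ.map_source h.mem_source)).hasFDerivAt.comp p
    h.hasStrictFDerivAt.hasFDerivAt
  have h2 : φ.symm ∘ φ =ᶠ[𝓝 p] id := φ.eventually_left_inverse h.mem_source
  exact DFunLike.congr_fun (h1.unique ((hasFDerivAt_id p).congr_of_eventuallyEq h2)) τ

lemma fderiv_fderiv_symm (h : IsConicChart M p φ C) (σ : EuclideanSpace ℝ (Fin m)) :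
    fderiv ℝ φ p (fderiv ℝ φ.symm (φ p) σ) = σ := by
  have h0 := φ.map_source h.mem_source
  have h3 : HasFDerivAt φ (fderiv ℝ φ p) (φ.symm (φ p)) := by
    rw [φ.left_inv h.mem_source]
    exact h.hasStrictFDerivAt.hasFDerivAt
  have h1 := h3.comp (φ p) (h.hasStrictFDerivAt_symm h0).hasFDerivAt
  have h2 : φ ∘ φ.symm =ᶠ[𝓝 (φ p)] id := φ.eventually_right_inverse h0
  exact DFunLike.congr_fun (h1.unique ((hasFDerivAt_id _).congr_of_eventuallyEq h2)) σ

/-- Moving in the chart along a direction of the cone does not leave the set. -/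
lemma symm_add_mem (h : IsConicChart M p φ C) {z : E} (hz : z ∈ φ.source) (hzM : z ∈ M)
    {σ : EuclideanSpace ℝ (Fin m)} (hσ : σ ∈ C) (ht : φ z + σ ∈ φ.target) :
    φ.symm (φ z + σ) ∈ M := by
  rw [h.mem_iff _ (φ.map_target ht), φ.right_inv ht, add_sub_right_comm]
  exact C.add_mem ((h.mem_iff z hz).1 hzM) hσ

/-- At every point `z ∈ M` of the chart domain, the image of `C` under the derivative of the inverse
chart consists of velocities of curves in `M`. It may be a proper part of the tangent cone at `z`
(in the interior of a half-space, for instance), but it depends continuously on `z`, as is needed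
to pass to limits of normals. -/
lemma inner_fderiv_symm_le_zero (h : IsConicChart M p φ C) {z v : E} (hz : z ∈ φ.source)
    (hzM : z ∈ M) (hv : v ∈ frechetNormalCone M z) {σ : EuclideanSpace ℝ (Fin m)}
    (hσ : σ ∈ C) : inner ℝ v (fderiv ℝ φ.symm (φ z) σ) ≤ 0 := by
  have hline : HasDerivAt (fun s : ℝ => φ z + s • σ) σ 0 := by
    simpa using ((hasDerivAt_id (0 : ℝ)).smul_const σ).const_add (φ z)
  have hzt := φ.map_source hz
  have h1 : HasFDerivAt φ.symm (fderiv ℝ φ.symm (φ z)) (φ z + (0 : ℝ) • σ) := by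
    simpa using (h.hasStrictFDerivAt_symm hzt).hasFDerivAt
  refine inner_le_zero_of_curve hv (h1.comp_hasDerivAt (0 : ℝ) hline)
    (by simp [φ.left_inv hz]) ?_
  have h2 : ∀ᶠ s in 𝓝 (0 : ℝ), φ z + s • σ ∈ φ.target :=
    hline.continuousAt.eventually_mem (φ.open_target.mem_nhds (by simpa using hzt))
  filter_upwards [nhdsWithin_le_nhds h2, self_mem_nhdsWithin] with s hs (hs0 : 0 < s)
  exact h.symm_add_mem hz hzM (C.smul_mem hs0.le hσ) hs

lemma inner_le_zero_of_mem_limiting (h : IsConicChart M p φ C) {v τ : E}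
    (hv : v ∈ limitingNormalCone M p) (hτ : τ ∈ chartTangentCone p φ C) :
    inner ℝ v τ ≤ 0 := by
  obtain ⟨z, w, hzM, hw, hz, hwv⟩ := hv
  have hcont : ContinuousAt (fun z => fderiv ℝ φ.symm (φ z) (fderiv ℝ φ p τ)) p := by
    have h1 : ContinuousAt (fderiv ℝ φ.symm) (φ p) :=
      (h.contDiffAt_symm (φ.map_source h.mem_source)).continuousAt_fderiv one_ne_zero
    have h2 : ContinuousAt (fun z => fderiv ℝ φ.symm (φ z)) p :=
      ContinuousAt.comp (f := φ) h1 (φ.continuousAt h.mem_source)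
    exact h2.clm_apply continuousAt_const
  have hlim := hwv.inner (𝕜 := ℝ) (hcont.tendsto.comp hz)
  rw [h.fderiv_symm_fderiv] at hlim
  refine le_of_tendsto hlim ?_
  filter_upwards [hz.eventually (φ.open_source.mem_nhds h.mem_source)] with i hi
  exact h.inner_fderiv_symm_le_zero hi (hzM i) (hw i) hτ

/-- Each `z ∈ M` differs from `p` by a tangent vector up to `o(‖z - p‖)`, namely by the image of
`φ z - φ p ∈ C` under the derivative of the inverse chart. -/
lemma mem_frechetNormalCone_of_polar (h : IsConicChart M p φ C) {v : E}
    (hv : ∀ τ ∈ chartTangentCone p φ C, inner ℝ v τ ≤ 0) : v ∈ frechetNormalCone M p := by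
  refine mem_frechet_of_eventually fun ε hε => ?_
  set B := fderiv ℝ φ.symm (φ p) with hB
  have hF : HasFDerivAt (fun z => B (φ z)) (ContinuousLinearMap.id ℝ E) p := by
    have h1 := B.hasFDerivAt.comp p h.hasStrictFDerivAt.hasFDerivAt
    have h2 : B.comp (fderiv ℝ φ p) = ContinuousLinearMap.id ℝ E :=
      ContinuousLinearMap.ext h.fderiv_symm_fderiv
    rwa [h2] at h1
  have hlo := hF.isLittleO.def (c := ε / (‖v‖ + 1)) (by positivity)
  filter_upwards [nhdsWithin_le_nhds hlo, self_mem_nhdsWithin,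
    nhdsWithin_le_nhds (φ.open_source.mem_nhds h.mem_source)] with z hz hzM hzs
  have htan : B (φ z - φ p) ∈ chartTangentCone p φ C := by
    rw [mem_chartTangentCone, hB, h.fderiv_fderiv_symm]
    exact (h.mem_iff z hzs).1 hzM
  have h3 : ‖B (φ z - φ p) - (z - p)‖ ≤ ε / (‖v‖ + 1) * ‖z - p‖ := by
    simpa [map_sub] using hz
  have h4 : ‖v‖ * (ε / (‖v‖ + 1)) ≤ ε := by
    rw [mul_div_assoc', div_le_iff₀ (by positivity)]
    nlinarith
  calc inner ℝ v (z - p)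
      = inner ℝ v (B (φ z - φ p)) + inner ℝ v (-(B (φ z - φ p) - (z - p))) := by
        rw [← inner_add_right]; congr 1; abel
    _ ≤ 0 + ‖v‖ * ‖-(B (φ z - φ p) - (z - p))‖ := add_le_add (hv _ htan) (real_inner_le_norm _ _)
    _ ≤ ‖v‖ * (ε / (‖v‖ + 1) * ‖z - p‖) := by rw [zero_add, norm_neg]; gcongr
    _ = ‖v‖ * (ε / (‖v‖ + 1)) * ‖z - p‖ := by ring
    _ ≤ ε * ‖z - p‖ := by gcongr

lemma mem_limitingNormalCone_of_polar (h : IsConicChart M p φ C) (hp : p ∈ M) {v : E}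
    (hv : ∀ τ ∈ chartTangentCone p φ C, inner ℝ v τ ≤ 0) : v ∈ limitingNormalCone M p :=
  ⟨fun _ => p, fun _ => v, fun _ => hp, fun _ => h.mem_frechetNormalCone_of_polar hv,
    tendsto_const_nhds, tendsto_const_nhds⟩

/-- Contingent directions are tangent. -/
lemma mem_chartTangentCone_of_seq (h : IsConicChart M p φ C) {τ : E} {s : ℕ → ℝ} {w : ℕ → E}
    (hs : ∀ k, 0 < s k) (hs0 : Tendsto s atTop (𝓝 0)) (hw : Tendsto w atTop (𝓝 τ))
    (hM : ∀ k, p + s k • w k ∈ M) : τ ∈ chartTangentCone p φ C := by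
  have hlim : Tendsto (fun k => p + s k • w k) atTop (𝓝 p) := by
    simpa using (hs0.smul hw).const_add p
  have hc : Tendsto (fun k => (s k)⁻¹ • (s k • w k)) atTop (𝓝 τ) :=
    hw.congr fun k => (inv_smul_smul₀ (hs k).ne' _).symm
  have hd : Tendsto (fun k => s k • w k) atTop (𝓝 0) := by simpa using hs0.smul hw
  have h1 := h.hasStrictFDerivAt.hasFDerivAt.hasFDerivWithinAt.lim (s := Set.univ)
    (c := fun k => (s k)⁻¹) hd (Eventually.of_forall fun _ => Set.mem_univ _) hc
  refine h.isClosed.mem_of_tendsto h1 ?_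
  filter_upwards [hlim.eventually (φ.open_source.mem_nhds h.mem_source)] with k hk
  exact C.smul_mem (inv_nonneg.2 (hs k).le) ((h.mem_iff _ hk).1 (hM k))

/-- From every point of `M` near `p` starts, for each tangent vector `τ` at `p`, a curve in `M` that
stays within `η s` of the straight motion with velocity `τ`, over a common time interval. -/
lemma exists_uniform_curves (h : IsConicChart M p φ C) {τ : E}
    (hτ : τ ∈ chartTangentCone p φ C) {η : ℝ} (hη : 0 < η) :
    ∃ s₀ > 0, ∀ᶠ q in 𝓝[M] p, ∃ γ : ℝ → E, ContinuousOn γ (Set.Icc 0 s₀) ∧ γ 0 = q ∧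
      ∀ s ∈ Set.Icc 0 s₀, γ s ∈ M ∧ ‖γ s - q - s • τ‖ ≤ η * s := by
  set σ := fderiv ℝ φ p τ with hσ
  set B := fderiv ℝ φ.symm (φ p) with hB
  have hpt := φ.map_source h.mem_source
  have hlo := (h.hasStrictFDerivAt_symm hpt).isLittleO.def (c := η / (‖σ‖ + 1)) (by positivity)
  rw [nhds_prod_eq] at hlo
  obtain ⟨U, hU, hUlo⟩ := (Filter.eventually_prod_self_iff
    (r := fun y₁ y₂ => ‖φ.symm y₁ - φ.symm y₂ - B (y₁ - y₂)‖ ≤ η / (‖σ‖ + 1) * ‖y₁ - y₂‖)).1 hlo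
  obtain ⟨r, hr, hrU⟩ := Metric.mem_nhds_iff.1
    (Filter.inter_mem hU (φ.open_target.mem_nhds hpt))
  refine ⟨r / (2 * (‖σ‖ + 1)), by positivity, ?_⟩
  have hnear : ∀ᶠ q in 𝓝 p, φ q ∈ Metric.ball (φ p) (r / 2) :=
    (φ.continuousAt h.mem_source).eventually_mem (Metric.ball_mem_nhds _ (by positivity))
  filter_upwards [nhdsWithin_le_nhds hnear, self_mem_nhdsWithin,
    nhdsWithin_le_nhds (φ.open_source.mem_nhds h.mem_source)] with q hq hqM hqs
  have hball : ∀ s ∈ Set.Icc 0 (r / (2 * (‖σ‖ + 1))), φ q + s • σ ∈ Metric.ball (φ p) r := by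
    intro s hs
    have h1 : ‖s • σ‖ ≤ r / 2 := by
      rw [norm_smul, Real.norm_of_nonneg hs.1]
      calc s * ‖σ‖ ≤ r / (2 * (‖σ‖ + 1)) * (‖σ‖ + 1) := by
            have := hs.2
            gcongr
            linarith
        _ = r / 2 := by field_simp
    rw [Metric.mem_ball, dist_eq_norm] at hq ⊢
    calc ‖φ q + s • σ - φ p‖ = ‖(φ q - φ p) + s • σ‖ := by congr 1; abel
      _ ≤ ‖φ q - φ p‖ + ‖s • σ‖ := norm_add_le _ _
      _ < r := by linarith
  refine ⟨fun s => φ.symm (φ q + s • σ), ?_, by simp [φ.left_inv hqs], fun s hs => ⟨?_, ?_⟩⟩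
  · exact φ.continuousOn_symm.comp (by fun_prop) fun s hs => (hrU (hball s hs)).2
  · exact h.symm_add_mem hqs hqM (C.smul_mem hs.1 hτ) (hrU (hball s hs)).2
  · have hqU : φ q ∈ U :=
      (hrU (Metric.ball_subset_ball (by linarith) hq)).1
    have h1 := hUlo _ (hrU (hball s hs)).1 _ hqU
    simp only [add_sub_cancel_left, φ.left_inv hqs, map_smul] at h1
    rw [hσ, h.fderiv_symm_fderiv, ← hσ, norm_smul, Real.norm_of_nonneg hs.1] at h1
    refine h1.trans ?_
    have h2 : η / (‖σ‖ + 1) * ‖σ‖ ≤ η := by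
      rw [div_mul_eq_mul_div, div_le_iff₀ (by positivity)]
      nlinarith
    calc η / (‖σ‖ + 1) * (s * ‖σ‖) = η / (‖σ‖ + 1) * ‖σ‖ * s := by ring
      _ ≤ η * s := mul_le_mul_of_nonneg_right h2 hs.1

end IsConicChart

/-! ### Conic charts of manifolds -/

lemma IsC1Submanifold.exists_isConicChart {d : ℕ} {M : Set E} (hM : IsC1Submanifold m d M)
    {p : E} (hp : p ∈ M) : ∃ (φ : OpenPartialHomeomorph E (EuclideanSpace ℝ (Fin m)))
      (C : PointedCone ℝ (EuclideanSpace ℝ (Fin m))), IsConicChart M p φ C := by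
  obtain ⟨φ, hps, hφ, hmem⟩ := hM.2 p hp
  let L : Submodule ℝ (EuclideanSpace ℝ (Fin m)) :=
    { carrier := {y | ∀ i : Fin m, d ≤ (i : ℕ) → y i = 0}
      add_mem' := fun ha hb i hi => by simp [ha i hi, hb i hi]
      zero_mem' := fun i _ => by simp
      smul_mem' := fun c y hy i hi => by simp [hy i hi] }
  refine ⟨φ, PointedCone.ofSubmodule L, hps, hφ, L.closed_of_finiteDimensional, fun z hz => ?_⟩
  have hpL : φ p ∈ L := (hmem p hps).1 hp
  rw [hmem z hz, PointedCone.mem_ofSubmodule_iff, L.sub_mem_iff_left hpL]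
  rfl

lemma IsC1FullDimWithBoundary.exists_isConicChart {n : ℕ} {M : Set E}
    (hM : IsC1FullDimWithBoundary n M) {p : E} (hp : p ∈ M) :
    ∃ (φ : OpenPartialHomeomorph E (EuclideanSpace ℝ (Fin (n + 1))))
      (C : PointedCone ℝ (EuclideanSpace ℝ (Fin (n + 1)))), IsConicChart M p φ C := by
  obtain ⟨φ, hps, hφ, hmem⟩ := hM p hp
  rcases ((hmem p hps).1 hp).eq_or_lt with h0 | h0
  · let H : PointedCone ℝ (EuclideanSpace ℝ (Fin (n + 1))) :=
      (PointedCone.positive ℝ ℝ).comap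
        (EuclideanSpace.proj (𝕜 := ℝ) (0 : Fin (n + 1)) :
          EuclideanSpace ℝ (Fin (n + 1)) →ₗ[ℝ] ℝ)
    refine ⟨φ, H, hps, hφ, ?_, fun z hz => ?_⟩
    · exact isClosed_Ici.preimage (EuclideanSpace.proj (𝕜 := ℝ) (0 : Fin (n + 1))).continuous
    · rw [hmem z hz]
      change _ ↔ 0 ≤ (φ z - φ p) 0
      simp [← h0]
  · -- At an interior point the chart is shrunk to stay inside the open half-space.
    let V : Set (EuclideanSpace ℝ (Fin (n + 1))) := {y | 0 < y 0}
    have hV : IsOpen V :=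
      isOpen_Ioi.preimage (EuclideanSpace.proj (𝕜 := ℝ) (0 : Fin (n + 1))).continuous
    let ψ := φ.restrOpen (φ.source ∩ φ ⁻¹' V) (φ.isOpen_inter_preimage hV)
    have hsub : ψ.source ⊆ φ.source := fun z hz => hz.1
    have htsub : ψ.target ⊆ φ.target := fun z hz => hz.1
    refine ⟨ψ, ⊤, ⟨hps, hps, h0⟩, ⟨hφ.1.mono hsub, hφ.2.mono htsub⟩, isClosed_univ,
      fun z hz => ?_⟩
    have hz0 : 0 < φ z 0 := hz.2.2
    simp only [Submodule.mem_top, iff_true]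
    exact (hmem z hz.1).2 hz0.le

end ConicCharts

/-! ### Tangent vectors with unit time component -/

section Moduli

variable {n m : ℕ} {S : ℝ → Set (EuclideanSpace ℝ (Fin n))} {t : ℝ}
  {x : EuclideanSpace ℝ (Fin n)}
  {φ : OpenPartialHomeomorph (WithLp 2 (ℝ × EuclideanSpace ℝ (Fin n)))
    (EuclideanSpace ℝ (Fin m))}
  {C : PointedCone ℝ (EuclideanSpace ℝ (Fin m))}

/-- The tangent vector is a limit of difference quotients of the points of `S t₁` that the calmness
condition provides for `x` itself, as `t₁` decreases to `t`. -/
lemma exists_tangent_of_calm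
    (h : IsConicChart (graph S) (WithLp.toLp 2 (t, x)) φ C) (hx : x ∈ S t) {κ ε δ : ℝ}
    (hε : 0 < ε) (hδ : 0 < δ)
    (hcalm : ∀ t₁ ∈ Set.Ioo t (t + ε), S t ∩ Metric.ball x δ ⊆
      S t₁ + (κ * |t₁ - t|) • Metric.ball (0 : EuclideanSpace ℝ (Fin n)) 1) :
    ∃ w, ‖w‖ ≤ |κ| ∧ WithLp.toLp 2 ((1 : ℝ), w) ∈
      chartTangentCone (WithLp.toLp 2 (t, x)) φ C := by
  set s : ℕ → ℝ := fun k => ε / (k + 2) with hsdef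
  have hs : ∀ k, 0 < s k := fun k => by positivity
  have hsε : ∀ k, s k < ε := fun k => by
    rw [hsdef]
    refine div_lt_self hε ?_
    have : (0 : ℝ) ≤ k := k.cast_nonneg
    linarith
  have hs0 : Tendsto s atTop (𝓝 0) := by
    have h1 : Tendsto (fun k : ℕ => (k : ℝ) + 2) atTop atTop :=
      tendsto_atTop_add_const_right _ _ tendsto_natCast_atTop_atTop
    exact h1.const_div_atTop ε
  have hw : ∀ k, ∃ w : EuclideanSpace ℝ (Fin n), ‖w‖ ≤ |κ| ∧ x + s k • w ∈ S (t + s k) := by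
    intro k
    obtain ⟨y, hy, b, hb, hyb⟩ := Set.mem_add.1
      (hcalm (t + s k) ⟨by linarith [hs k], by linarith [hsε k]⟩
        ⟨hx, Metric.mem_ball_self hδ⟩)
    obtain ⟨c, hc, rfl⟩ := Set.mem_smul_set.1 hb
    rw [add_sub_cancel_left, abs_of_pos (hs k)] at hyb
    refine ⟨-(κ • c), ?_, ?_⟩
    · rw [norm_neg, norm_smul, Real.norm_eq_abs]
      have : ‖c‖ ≤ 1 := (mem_ball_zero_iff.1 hc).le
      exact mul_le_of_le_one_right (abs_nonneg _) this
    · convert hy using 1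
      rw [← hyb, smul_neg, smul_smul, mul_comm κ]
      abel
  choose w hwκ hwS using hw
  obtain ⟨w₀, hw₀, f, hf, hlim⟩ := (isCompact_closedBall (0 : EuclideanSpace ℝ (Fin n))
    |κ|).tendsto_subseq (x := w) fun k => by simpa using hwκ k
  refine ⟨w₀, by simpa using hw₀, ?_⟩
  refine h.mem_chartTangentCone_of_seq (s := s ∘ f)
    (w := fun k => WithLp.toLp 2 ((1 : ℝ), w (f k))) (fun k => hs _)
    (hs0.comp hf.tendsto_atTop) ?_ fun k => ?_
  · exact ((WithLp.prod_continuous_toLp 2 _ _).tendsto _).comp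
      (tendsto_const_nhds.prodMk_nhds hlim)
  · simpa [graph] using hwS (f k)

/-- A hyperplane separating the tangent cone from the compact set of vectors `(1, w)`, `‖w‖ ≤ κ`,
would have a normal that the bound on the coderivative forbids. -/
lemma exists_tangent_of_asymModulus_le
    (h : IsConicChart (graph S) (WithLp.toLp 2 (t, x)) φ C) (hx : x ∈ S t) {κ : ℝ}
    (hκ : 0 ≤ κ) (hle : asymModulus S t x ≤ ENNReal.ofReal κ) :
    ∃ w, ‖w‖ ≤ κ ∧ WithLp.toLp 2 ((1 : ℝ), w) ∈
      chartTangentCone (WithLp.toLp 2 (t, x)) φ C := by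
  by_contra! hno
  set K := chartTangentCone (WithLp.toLp 2 (t, x)) φ C with hK
  set Q : Set (WithLp 2 (ℝ × EuclideanSpace ℝ (Fin n))) :=
    (WithLp.prodContinuousLinearEquiv 2 ℝ ℝ (EuclideanSpace ℝ (Fin n))).symm ''
      ({(1 : ℝ)} ×ˢ Metric.closedBall 0 κ) with hQ
  have hQmem : ∀ w : EuclideanSpace ℝ (Fin n), ‖w‖ ≤ κ → WithLp.toLp 2 ((1 : ℝ), w) ∈ Q :=
    fun w hw => ⟨(1, w), ⟨rfl, by simpa using hw⟩, rfl⟩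
  have hQcomp : IsCompact Q :=
    (isCompact_singleton.prod (isCompact_closedBall _ _)).image
      (ContinuousLinearEquiv.continuous _)
  have hQconv : Convex ℝ Q :=
    ((convex_singleton _).prod (convex_closedBall _ _)).linear_image
      (WithLp.prodContinuousLinearEquiv 2 ℝ ℝ
        (EuclideanSpace ℝ (Fin n))).symm.toLinearEquiv.toLinearMap
  have hdisj : Disjoint (K : Set (WithLp 2 (ℝ × EuclideanSpace ℝ (Fin n)))) Q := by
    rw [Set.disjoint_left]
    rintro _ hk ⟨⟨a, w⟩, ⟨rfl, hw⟩, rfl⟩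
    exact hno w (by simpa using hw) hk
  obtain ⟨f, b, c, hfK, hbc, hfQ⟩ := geometric_hahn_banach_closed_compact K.convex
    h.isClosed_chartTangentCone hQconv hQcomp hdisj
  have hb : 0 < b := by simpa using hfK 0 K.zero_mem
  -- A linear functional bounded above on a cone is nonpositive there.
  have hfK0 : ∀ τ ∈ K, f τ ≤ 0 := by
    intro τ hτ
    by_contra! hpos
    have := hfK _ (K.smul_mem (div_nonneg hb.le hpos.le) hτ)
    rw [map_smul, smul_eq_mul, div_mul_cancel₀ _ hpos.ne'] at this
    exact lt_irrefl _ this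
  set v := (InnerProductSpace.toDual ℝ (WithLp 2 (ℝ × EuclideanSpace ℝ (Fin n)))).symm f with hv
  have hvf : ∀ y, inner ℝ v y = f y := fun y => InnerProductSpace.toDual_symm_apply
  set a : ℝ := v.fst with ha
  set u : EuclideanSpace ℝ (Fin n) := -v.snd with hu
  have hpair : ∀ w : EuclideanSpace ℝ (Fin n), ‖w‖ ≤ κ → 0 < a - inner ℝ u w := by
    intro w hw
    have h1 := (hb.trans hbc).trans (hfQ _ (hQmem w hw))
    rw [← hvf, WithLp.prod_inner_apply] at h1
    simpa [ha, hu] using h1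
  have hscale : ∀ r : ℝ, 0 ≤ r → r * ‖u‖ ≤ 1 → r * a ≤ κ := by
    intro r hr hru
    have hmem : r * a ∈ coderivative S t x (r • u) := by
      change WithLp.toLp 2 (r * a, -(r • u)) ∈ limitingNormalCone (graph S) (WithLp.toLp 2 (t, x))
      have hrv : WithLp.toLp 2 (r * a, -(r • u)) = r • v := by
        apply WithLp.ofLp_injective 2
        exact Prod.ext (by simp [ha]) (by simp [hu])
      rw [hrv]
      refine h.mem_limitingNormalCone_of_polar hx fun τ (hτ : τ ∈ K) => ?_
      rw [real_inner_smul_left, hvf]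
      exact mul_nonpos_of_nonneg_of_nonpos hr (hfK0 τ hτ)
    have hmax : ENNReal.ofReal (max 0 (r * a)) ≤ ENNReal.ofReal κ :=
      (sSup_le_iff.1 hle) _ ⟨r • u, r * a, by rwa [norm_smul, Real.norm_of_nonneg hr], hmem, rfl⟩
    exact (le_max_right _ _).trans ((ENNReal.ofReal_le_ofReal_iff hκ).1 hmax)
  have ha0 : 0 < a := by simpa using hpair 0 (by simpa using hκ)
  rcases eq_or_ne u 0 with hu0 | hu0
  · have := hscale ((κ + 1) / a) (by positivity) (by simp [hu0])
    rw [div_mul_cancel₀ _ ha0.ne'] at this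
    linarith
  · have hun : 0 < ‖u‖ := norm_pos_iff.2 hu0
    have h1 := hscale ‖u‖⁻¹ (by positivity) (inv_mul_cancel₀ hun.ne').le
    have h2 := hpair ((κ / ‖u‖) • u) (by
      rw [norm_smul, Real.norm_of_nonneg (by positivity), div_mul_cancel₀ _ hun.ne'])
    rw [real_inner_smul_right, real_inner_self_eq_norm_sq, sq, ← mul_assoc,
      div_mul_cancel₀ _ hun.ne'] at h2
    rw [inv_mul_le_iff₀ hun] at h1
    linarith

/-- The strict inequality leaves room for the relative error of the approximating curves. -/
lemma calm_of_tangent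
    (h : IsConicChart (graph S) (WithLp.toLp 2 (t, x)) φ C) {w : EuclideanSpace ℝ (Fin n)}
    (hw : WithLp.toLp 2 ((1 : ℝ), w) ∈ chartTangentCone (WithLp.toLp 2 (t, x)) φ C)
    {κ : ℝ} (hκ : ‖w‖ < κ) :
    ∃ ε > 0, ∃ δ > 0, ∀ t₁ ∈ Set.Ioo t (t + ε), S t ∩ Metric.ball x δ ⊆
      S t₁ + (κ * |t₁ - t|) • Metric.ball (0 : EuclideanSpace ℝ (Fin n)) 1 := by
  have hκ0 : 0 < κ := (norm_nonneg w).trans_lt hκ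
  -- The relative error `η` has to satisfy `‖w‖ + η < κ (1 - η)`.
  obtain ⟨η, hη, hη1, hηκ⟩ : ∃ η : ℝ, 0 < η ∧ η < 1 ∧ ‖w‖ + η < κ * (1 - η) := by
    refine ⟨(κ - ‖w‖) / (2 * (κ + 1)), by have := sub_pos.2 hκ; positivity, ?_, ?_⟩
    · rw [div_lt_one (by positivity)]
      linarith [norm_nonneg w]
    · have : (κ - ‖w‖) / (2 * (κ + 1)) * (κ + 1) = (κ - ‖w‖) / 2 := by field_simp
      linarith
  obtain ⟨s₀, hs₀, hcurves⟩ := h.exists_uniform_curves hw hη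
  rw [eventually_nhdsWithin_iff] at hcurves
  have hincl : Tendsto (fun x' : EuclideanSpace ℝ (Fin n) => WithLp.toLp 2 (t, x')) (𝓝 x)
      (𝓝 (WithLp.toLp 2 (t, x))) :=
    ((WithLp.prod_continuous_toLp 2 _ _).comp (by fun_prop : Continuous fun x' => (t, x'))).tendsto x
  obtain ⟨δ, hδ, hδc⟩ := Metric.eventually_nhds_iff_ball.1 (hincl.eventually hcurves)
  refine ⟨(1 - η) * s₀, mul_pos (by linarith) hs₀, δ, hδ, ?_⟩
  rintro t₁ ⟨ht₁, ht₁'⟩ x' ⟨hx', hx'δ⟩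
  obtain ⟨γ, hγc, hγ0, hγ⟩ := hδc x' hx'δ hx'
  have htime : ∀ s ∈ Set.Icc 0 s₀, |(γ s).fst - t - s| ≤ η * s := fun s hs => by
    have h1 := (WithLp.norm_fst_le _ _).trans (hγ s hs).2
    simpa using h1
  have hspace : ∀ s ∈ Set.Icc 0 s₀, ‖(γ s).snd - x' - s • w‖ ≤ η * s := fun s hs => by
    have h1 := (WithLp.norm_snd_le _ _).trans (hγ s hs).2
    simpa using h1
  have hfc : ContinuousOn (fun s => (γ s).fst) (Set.Icc 0 s₀) :=
    (WithLp.fstL 2 ℝ ℝ (EuclideanSpace ℝ (Fin n))).continuous.comp_continuousOn hγc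
  obtain ⟨s, hs, hst⟩ := intermediate_value_Icc hs₀.le hfc (show t₁ ∈ Set.Icc _ _ from
    ⟨by simpa [hγ0] using ht₁.le, by
      have := (abs_le.1 (htime s₀ ⟨hs₀.le, le_rfl⟩)).1
      linarith⟩)
  have hst : (γ s).fst = t₁ := hst
  have hspos : 0 < s := by
    refine lt_of_le_of_ne hs.1 fun h0 => ?_
    rw [← h0, hγ0] at hst
    exact ht₁.ne hst
  have hs1 : (1 - η) * s ≤ t₁ - t := by
    have := (abs_le.1 (htime s hs)).1
    rw [hst] at this
    linarith
  have hdist : ‖x' - (γ s).snd‖ < κ * (t₁ - t) := by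
    calc ‖x' - (γ s).snd‖ = ‖s • w + ((γ s).snd - x' - s • w)‖ := by
          rw [← norm_neg]; congr 1; abel
      _ ≤ s * ‖w‖ + η * s := by
          refine (norm_add_le _ _).trans (add_le_add ?_ (hspace s hs))
          rw [norm_smul, Real.norm_of_nonneg hspos.le]
      _ = (‖w‖ + η) * s := by ring
      _ < κ * (1 - η) * s := by gcongr
      _ = κ * ((1 - η) * s) := by ring
      _ ≤ κ * (t₁ - t) := by gcongr
  have hr : 0 < κ * |t₁ - t| := mul_pos hκ0 (abs_pos.2 (sub_ne_zero.2 ht₁.ne'))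
  refine Set.mem_add.2 ⟨(γ s).snd, ?_, x' - (γ s).snd, ?_, by abel⟩
  · have := (hγ s hs).1
    change (γ s).snd ∈ S (γ s).fst at this
    rwa [hst] at this
  · rw [smul_unitBall_of_pos hr, mem_ball_zero_iff, abs_of_pos (sub_pos.2 ht₁)]
    exact hdist

end Moduli

/-! ### Equality of the moduli -/

lemma IsSmoothSweepingProcess.exists_isConicChart {n : ℕ}
    {S : ℝ → Set (EuclideanSpace ℝ (Fin n))} (hS : IsSmoothSweepingProcess S)
    {p : WithLp 2 (ℝ × EuclideanSpace ℝ (Fin n))} (hp : p ∈ graph S) :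
    ∃ (φ : OpenPartialHomeomorph (WithLp 2 (ℝ × EuclideanSpace ℝ (Fin n)))
        (EuclideanSpace ℝ (Fin (n + 1))))
      (C : PointedCone ℝ (EuclideanSpace ℝ (Fin (n + 1)))), IsConicChart (graph S) p φ C := by
  rcases hS.2.2 with ⟨d, -, hd⟩ | ⟨hb, -⟩
  · exact hd.exists_isConicChart hp
  · exact hb.exists_isConicChart hp

end SweepingProcess

open SweepingProcess in
theorem proposition4p8 (n : ℕ) (S : ℝ → Set (EuclideanSpace ℝ (Fin n)))
    (hS : SweepingProcess.IsSmoothSweepingProcess S)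
    (t : ℝ) (ht : t ∈ SweepingProcess.dom S) (htT : (t : EReal) ≠ SweepingProcess.supDom S)
    (x : EuclideanSpace ℝ (Fin n)) (hx : x ∈ S t)
    (hfin : SweepingProcess.asymModulus S t x < ⊤) :
    SweepingProcess.calmUp S t x = SweepingProcess.asymModulus S t x := by
  obtain ⟨φ, C, h⟩ := hS.exists_isConicChart (p := WithLp.toLp 2 (t, x)) hx
  apply le_antisymm
  · refine ENNReal.le_of_forall_pos_le_add fun r hr _ => ?_
    obtain ⟨w, hw, hwK⟩ := exists_tangent_of_asymModulus_le h hx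
      ENNReal.toReal_nonneg (ENNReal.ofReal_toReal hfin.ne).ge
    have hr' : (0 : ℝ) < r := hr
    refine sInf_le ⟨(asymModulus S t x).toReal + r,
      add_pos_of_nonneg_of_pos ENNReal.toReal_nonneg hr', ?_,
      calm_of_tangent h hwK (by linarith)⟩
    rw [ENNReal.ofReal_add ENNReal.toReal_nonneg hr'.le, ENNReal.ofReal_toReal hfin.ne,
      ENNReal.ofReal_coe_nnreal]
  · refine le_sInf ?_
    rintro _ ⟨κ, hκ, rfl, ε, hε, δ, hδ, hcalm⟩
    refine sSup_le ?_
    rintro _ ⟨u, a, hu, ha, rfl⟩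
    obtain ⟨w, hw, hwK⟩ := exists_tangent_of_calm h hx hε hδ hcalm
    rw [abs_of_pos hκ] at hw
    have h1 := h.inner_le_zero_of_mem_limiting ha hwK
    rw [WithLp.prod_inner_apply] at h1
    have h2 : a - inner ℝ u w ≤ 0 := by simpa [sub_eq_add_neg] using h1
    have h3 : inner ℝ u w ≤ κ := (real_inner_le_norm u w).trans
      ((mul_le_mul hu hw (norm_nonneg _) zero_le_one).trans_eq (one_mul κ))
    exact ENNReal.ofReal_le_ofReal (max_le hκ.le (by linarith))
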